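/- Let $R\subset\mathbb{R}^2$ be a polygonal region, i.e. a finite nonempty union of nondegenerate closed triangles (holes are allowed), and let $r>0$ be the communication radius. Scatter $n$ sensor nodes independently and uniformly at random in $R$ and join two distinct nodes by an edge when their Euclidean distance is at most $r$. For a node $v$ let $\mathrm{stress}(v,1)=\sum_{\{s,t\}}\sigma_{st}(v)$, where the sum is over unordered pairs of distinct nodes within hop distance $1$ of $v$ and $\sigma_{st}(v)$ is the number of shortest $s$–$t$ paths with $v$ as an inner vertex; this is the number of nonadjacent pairs of neighbours of $v$. Let $$E_n=(n-1)\,\frac{\pi r^2}{\mathrm{area}(R)}$$ be the expected number of neighbours of a node at distance at least $r$ from $\partial R$, and let $$\sigma=\frac{1}{\mathrm{area}(C)}\int_{C}\frac{\mathrm{area}(C\setminus C(w))}{\mathrm{area}(C)}\,dw\approx 0.4135,$$ where $C$ is the closed unit disk about the origin and $C(w)$ is the closed unit disk about $w$. For a constant $\theta$, a node $v$ declares itself a boundary node if $\mathrm{stress}(v,1)\le\theta\cdot\tfrac12E_n(E_n-1)$, and an interior node otherwise. Then for every $\varepsilon$ with $0<\varepsilon<r$ there is $\theta_0\in[0,\sigma)$,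 depending only on $R$, $r$ and $\varepsilon$, such that every constant threshold $\theta\in(\theta_0,\sigma)$ classifies the nodes correctly with high probability for sufficiently large node density: for every $p>0$ there is $\rho_0$ such that for every $n$ with $n/\mathrm{area}(R)\ge\rho_0$, with probability at least $1-p$, simultaneously every node at distance at most $\varepsilon$ from $\partial R$ declares itself a boundary node and every node at distance at least $r$ from $\partial R$ declares itself an interior node. -/

import Mathlib

open MeasureTheory ProbabilityTheory

open scoped Classical in
/-- `σ_st(v)`: the number of shortest paths from `s` to `t` in `G` that pass through `v`
as an inner vertex (a walk whose length is the graph distance is a path). -/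
noncomputable def SensorNetwork.shortestPathsThrough {V : Type*} (G : SimpleGraph V)
    (s t v : V) : ℕ :=
  if v = s ∨ v = t then 0
  else Set.ncard {p : G.Walk s t | p.length = G.dist s t ∧ v ∈ p.support}

open scoped Classical in
/-- `V_k(v)`: the vertices at hop distance at most `k` from `v`
(`edist` is infinite for vertices in different components). -/
noncomputable def SensorNetwork.hopBall {V : Type*} [Fintype V] (G : SimpleGraph V)
    (v : V) (k : ℕ) : Finset V :=
  {s : V | G.edist v s ≤ (k : ℕ∞)}

open scoped Classical in
/-- The restricted stress centrality `stress(v, k)`: the sum of `σ_st(v)` over all unordered pairs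
of distinct vertices `s, t` in `V_k(v)`, written as half of the sum over ordered pairs.
For `k = 1` this is the number of (unordered) nonadjacent pairs of neighbours of `v`. -/
noncomputable def SensorNetwork.restrictedStress {V : Type*} [Fintype V] (G : SimpleGraph V)
    (v : V) (k : ℕ) : ℝ :=
  ((∑ s ∈ SensorNetwork.hopBall G v k, ∑ t ∈ SensorNetwork.hopBall G v k with t ≠ s,
    SensorNetwork.shortestPathsThrough G s t v : ℕ) : ℝ) / 2

/-- The Euclidean plane. -/
abbrev SensorNetwork.Plane : Type := EuclideanSpace ℝ (Fin 2)

/-- A polygonal region: a finite union of (at least one) nondegenerate closed triangles.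
Holes are allowed, and neither convexity nor connectedness is asked for. -/
def SensorNetwork.IsPolygonalRegion (R : Set SensorNetwork.Plane) : Prop :=
  ∃ 𝒯 : Finset (Fin 3 → SensorNetwork.Plane), 𝒯.Nonempty ∧
    (∀ T ∈ 𝒯, AffineIndependent ℝ T) ∧ R = ⋃ T ∈ 𝒯, convexHull ℝ (Set.range T)

/-- The communication graph: two distinct nodes are joined when their positions are at Euclidean
distance at most `r`. -/
def SensorNetwork.commGraph {n : ℕ} (r : ℝ) (x : Fin n → SensorNetwork.Plane) :
    SimpleGraph (Fin n) where
  Adj i j := i ≠ j ∧ dist (x i) (x j) ≤ r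
  symm := ⟨fun _ _ h => ⟨h.1.symm, by rw [dist_comm]; exact h.2⟩⟩
  loopless := ⟨fun _ h => h.1 rfl⟩

/-- The law of `n` sensor nodes scattered independently and uniformly at random in `R`. -/
noncomputable def SensorNetwork.scatter (R : Set SensorNetwork.Plane) (n : ℕ) :
    Measure (Fin n → SensorNetwork.Plane) :=
  Measure.pi fun _ => ProbabilityTheory.cond volume R

/-- The expected number of neighbours of a node at distance at least `r` from the boundary of `R`,
when `n` nodes are scattered: each of the other `n - 1` nodes falls into its communication disk
with probability (area of the disk) / (area of `R`). -/
noncomputable def SensorNetwork.expectedDegree (R : Set SensorNetwork.Plane) (r : ℝ) (n : ℕ) : ℝ :=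
  ((n : ℝ) - 1) * (volume.real (Metric.closedBall (0 : SensorNetwork.Plane) r) / volume.real R)

/-- `σ`, the expected fraction of nonadjacent pairs of neighbours of an interior node:
with `C` the unit disk, the average over `w ∈ C` of `area (C \ disk about w) / area C`
(the value does not depend on the radius; it is about `0.4135`). -/
noncomputable def SensorNetwork.interiorFraction : ℝ :=
  (∫ w in Metric.closedBall (0 : SensorNetwork.Plane) 1,
      volume.real (Metric.closedBall (0 : SensorNetwork.Plane) 1 \ Metric.closedBall w 1) /
        volume.real (Metric.closedBall (0 : SensorNetwork.Plane) 1)) /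
    volume.real (Metric.closedBall (0 : SensorNetwork.Plane) 1)

/-- The classification rule with threshold `θ`: node `i` declares itself a boundary node when
`stress(i, 1) ≤ θ * (E[δ] choose 2)`, and an interior node otherwise. -/
def SensorNetwork.DeclaresBoundary (R : Set SensorNetwork.Plane) (r θ : ℝ) {n : ℕ}
    (x : Fin n → SensorNetwork.Plane) (i : Fin n) : Prop :=
  SensorNetwork.restrictedStress (SensorNetwork.commGraph r x) i 1 ≤
    θ * (SensorNetwork.expectedDegree R r n * (SensorNetwork.expectedDegree R r n - 1) / 2)

/-- All nodes are classified correctly: every node at distance at most `ε` from the boundary of `R`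
declares itself a boundary node, and every node whose distance to the boundary is at least
the communication radius `r` declares itself an interior node. -/
def SensorNetwork.ClassifiedCorrectly (R : Set SensorNetwork.Plane) (r ε θ : ℝ) {n : ℕ}
    (x : Fin n → SensorNetwork.Plane) : Prop :=
  ∀ i : Fin n,
    (Metric.infDist (x i) (frontier R) ≤ ε → SensorNetwork.DeclaresBoundary R r θ x i) ∧
    (r ≤ Metric.infDist (x i) (frontier R) → ¬ SensorNetwork.DeclaresBoundary R r θ x i)

/-! Twice the stress of a node is the number of ordered pairs of nodes in its communication disk
that are more than `r` apart (`two_mul_restrictedStress`). For a fixed set `B` of pairs, the number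
of sample pairs in `B` is about `n² q(B)`, where `q(B)` is the probability that two uniform points
of `R` form a pair in `B`; Chebyshev's inequality suffices (`measureReal_pairCount_deviation_le`).
With `c` the ratio of the disk's area to that of `R`, the threshold on this scale is `θ c² n²`.

For a disk inside `R`, `q` of its far pairs is exactly `σ c²`. For a centre closer than `r` to the
frontier it is strictly smaller, since a set of far pairs of positive measure is lost outside `R`
(`cond_prod_cond_real_farPairs_lt`).

The disks that matter have random centres, and there are `n` of them. Compactness removes both
difficulties: finitely many fixed disks, slightly enlarged near the frontier and slightly shrunk in
the interior, bound the far pairs of every communication disk concerned while keeping the strict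
inequalities for `q`. The union bound then runs over a number of events independent of `n`. -/

open MeasureTheory ProbabilityTheory Filter Topology
open scoped Pointwise

namespace SensorNetwork

/-! ### Concentration of the number of sample pairs in a fixed set -/

section PairCount

variable {E : Type*}

open scoped Classical in
/-- The number of ordered pairs of distinct indices whose positions form a pair in `B`. -/
noncomputable def pairCount (B : Set (E × E)) {n : ℕ} (x : Fin n → E) : ℝ :=
  ∑ j, ∑ k, if j = k then 0 else B.indicator 1 (x j, x k)

lemma pairCount_mono {B B' : Set (E × E)} (h : B ⊆ B') {n : ℕ} (x : Fin n → E) :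
    pairCount B x ≤ pairCount B' x := by
  unfold pairCount
  refine Finset.sum_le_sum fun j _ => Finset.sum_le_sum fun k _ => ?_
  split_ifs
  · exact le_rfl
  · exact Set.indicator_le_indicator_of_subset h (fun _ => zero_le_one) _

variable [MeasurableSpace E]

open scoped Classical in
/-- The centred indicator that the points with indices `j ≠ k` form a pair in `B`. -/
noncomputable def centredPair (μ : Measure E) (B : Set (E × E)) {n : ℕ} (j k : Fin n)
    (x : Fin n → E) : ℝ :=
  if j = k then 0 else B.indicator 1 (x j, x k) - (μ.prod μ).real B

variable (μ : Measure E) {B : Set (E × E)}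

lemma measurable_centredPair (hB : MeasurableSet B) {n : ℕ} (j k : Fin n) :
    Measurable (centredPair μ B j k) := by
  unfold centredPair
  split_ifs
  · exact measurable_const
  · exact ((measurable_one.indicator hB).comp
      ((measurable_pi_apply j).prodMk (measurable_pi_apply k))).sub_const _

lemma sum_centredPair (B : Set (E × E)) {n : ℕ} (x : Fin n → E) :
    ∑ j, ∑ k, centredPair μ B j k x = pairCount B x - n * (n - 1) * (μ.prod μ).real B := by
  classical
  have h : ∀ j k : Fin n, centredPair μ B j k x =
      (if j = k then 0 else B.indicator 1 (x j, x k)) -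
        ((μ.prod μ).real B - if j = k then (μ.prod μ).real B else 0) := by
    intro j k
    unfold centredPair
    split_ifs <;> simp
  simp only [h, pairCount, Finset.sum_sub_distrib]
  simp
  ring

variable [IsProbabilityMeasure μ]

lemma abs_centredPair_le (B : Set (E × E)) {n : ℕ} (j k : Fin n) (x : Fin n → E) :
    |centredPair μ B j k x| ≤ 1 := by
  unfold centredPair
  have h0 : 0 ≤ (μ.prod μ).real B := measureReal_nonneg
  have h1 : (μ.prod μ).real B ≤ 1 := measureReal_le_one
  split_ifs
  · simp
  · by_cases h : (x j, x k) ∈ B <;> simp only [h, Set.indicator_of_mem, Set.indicator_of_notMem,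
      not_false_eq_true, Pi.one_apply] <;> rw [abs_le] <;> constructor <;> linarith

lemma iIndepFun_eval (n : ℕ) :
    iIndepFun (fun (i : Fin n) (x : Fin n → E) => x i) (Measure.pi fun _ => μ) :=
  iIndepFun_pi (X := fun (_ : Fin n) (e : E) => e) fun _ => aemeasurable_id

lemma map_eval_pair {n : ℕ} {j k : Fin n} (h : j ≠ k) :
    (Measure.pi fun _ : Fin n => μ).map (fun x => (x j, x k)) = μ.prod μ := by
  have := ((iIndepFun_eval μ n).indepFun h)
  rw [indepFun_iff_map_prod_eq_prod_map_map (measurable_pi_apply j).aemeasurable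
    (measurable_pi_apply k).aemeasurable] at this
  rw [this, (measurePreserving_eval (fun _ : Fin n => μ) j).map_eq,
    (measurePreserving_eval (fun _ : Fin n => μ) k).map_eq]

lemma integral_centredPair (hB : MeasurableSet B) {n : ℕ} (j k : Fin n) :
    ∫ x, centredPair μ B j k x ∂(Measure.pi fun _ => μ) = 0 := by
  unfold centredPair
  by_cases h : j = k
  · simp [h]
  simp only [h, if_false]
  have hm : Measurable fun x : Fin n → E => (x j, x k) :=
    (measurable_pi_apply j).prodMk (measurable_pi_apply k)
  have hi : Measurable (B.indicator (1 : E × E → ℝ)) := measurable_one.indicator hB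
  have := integral_map (μ := Measure.pi fun _ : Fin n => μ) hm.aemeasurable
    (f := fun z => B.indicator (1 : E × E → ℝ) z - (μ.prod μ).real B)
    (hi.sub_const _).aestronglyMeasurable
  rw [← this, map_eval_pair μ h, integral_sub, integral_indicator_one hB]
  · simp
  · exact (integrable_const (1 : ℝ)).indicator hB
  · exact integrable_const _

lemma integrable_centredPair_mul (hB : MeasurableSet B) {n : ℕ} (j k j' k' : Fin n) :
    Integrable (fun x => centredPair μ B j k x * centredPair μ B j' k' x)
      (Measure.pi fun _ => μ) := by
  refine Integrable.of_bound (C := 1) ((measurable_centredPair μ hB j k).mul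
    (measurable_centredPair μ hB j' k')).aestronglyMeasurable (.of_forall fun x => ?_)
  rw [Real.norm_eq_abs, abs_mul]
  exact mul_le_one₀ (abs_centredPair_le μ B j k x) (abs_nonneg _) (abs_centredPair_le μ B j' k' x)

/-- Centred indicators on disjoint index pairs are independent with mean zero. Otherwise the product
is at most 1 and some coincidence on the right already contributes 1. -/
lemma integral_centredPair_mul_le (hB : MeasurableSet B) {n : ℕ} (j k j' k' : Fin n) :
    ∫ x, centredPair μ B j k x * centredPair μ B j' k' x ∂(Measure.pi fun _ => μ) ≤
      (if j = j' then 1 else 0) + (if j = k' then 1 else 0) +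
        (if k = j' then 1 else 0) + (if k = k' then 1 else 0) := by
  by_cases hdis : j ≠ j' ∧ j ≠ k' ∧ k ≠ j' ∧ k ≠ k'
  · obtain ⟨h1, h2, h3, h4⟩ := hdis
    have hind := (iIndepFun_eval μ n).indepFun_prodMk_prodMk (fun i => measurable_pi_apply i)
      j k j' k' h1 h2 h3 h4
    have hi : Measurable (B.indicator (1 : E × E → ℝ)) := measurable_one.indicator hB
    classical
    have hf : ∀ a b : Fin n, Measurable fun z : E × E =>
        if a = b then (0 : ℝ) else B.indicator 1 z - (μ.prod μ).real B := by
      intro a b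
      split_ifs
      · exact measurable_const
      · exact hi.sub_const _
    have hi2 := hind.comp (hf j k) (hf j' k')
    have := hi2.integral_fun_mul_eq_mul_integral
      ((hf j k).comp ((measurable_pi_apply j).prodMk (measurable_pi_apply k))).aestronglyMeasurable
      ((hf j' k').comp
        ((measurable_pi_apply j').prodMk (measurable_pi_apply k'))).aestronglyMeasurable
    have h0 := integral_centredPair μ hB j k
    have e1 : ∀ a b : Fin n, ((fun z : E × E => if a = b then (0 : ℝ)
        else B.indicator 1 z - (μ.prod μ).real B) ∘ fun x : Fin n → E => (x a, x b)) =
        centredPair μ B a b := by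
      intro a b; ext x; simp [centredPair]
    rw [e1, e1] at this
    rw [this, h0, zero_mul]
    simp [h1, h2, h3, h4]
  · have hle : ∫ x, centredPair μ B j k x * centredPair μ B j' k' x ∂(Measure.pi fun _ => μ)
        ≤ 1 := by
      calc _ ≤ ∫ x : Fin n → E, (1 : ℝ) ∂(Measure.pi fun _ => μ) := by
            refine integral_mono (integrable_centredPair_mul μ hB j k j' k')
              (integrable_const _) fun x => (le_abs_self _).trans ?_
            rw [abs_mul]
            exact mul_le_one₀ (abs_centredPair_le μ B j k x) (abs_nonneg _)
              (abs_centredPair_le μ B j' k' x)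
        _ = 1 := by simp
    refine hle.trans ?_
    split_ifs <;> first
      | (norm_num; done)
      | exact absurd ⟨by assumption, by assumption, by assumption, by assumption⟩ hdis

/-- In the fourfold sum for the square, each of the four possible coincidences leaves `n ^ 3` index
quadruples, so the variance is of smaller order than `n ^ 4`. -/
lemma integral_sq_pairCount_sub_le (hB : MeasurableSet B) (n : ℕ) :
    Integrable (fun x : Fin n → E => (pairCount B x - n * (n - 1) * (μ.prod μ).real B) ^ 2)
        (Measure.pi fun _ => μ) ∧
    ∫ x : Fin n → E, (pairCount B x - n * (n - 1) * (μ.prod μ).real B) ^ 2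
      ∂(Measure.pi fun _ => μ) ≤ 4 * (n : ℝ) ^ 3 := by
  have hexp : ∀ x : Fin n → E, (pairCount B x - n * (n - 1) * (μ.prod μ).real B) ^ 2 =
      ∑ j, ∑ k, ∑ j', ∑ k', centredPair μ B j k x * centredPair μ B j' k' x := by
    intro x
    rw [← sum_centredPair, sq, Finset.sum_mul]
    refine Finset.sum_congr rfl fun j _ => ?_
    rw [Finset.sum_mul]
    refine Finset.sum_congr rfl fun k _ => ?_
    rw [Finset.mul_sum]
    refine Finset.sum_congr rfl fun j' _ => ?_
    rw [Finset.mul_sum]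
  have hint := fun j k j' k' : Fin n => integrable_centredPair_mul μ hB j k j' k'
  simp only [hexp]
  refine ⟨integrable_finsetSum _ fun j _ => integrable_finsetSum _ fun k _ =>
    integrable_finsetSum _ fun j' _ => integrable_finsetSum _ fun k' _ => hint j k j' k', ?_⟩
  rw [integral_finsetSum _ fun j _ => integrable_finsetSum _ fun k _ =>
    integrable_finsetSum _ fun j' _ => integrable_finsetSum _ fun k' _ => hint j k j' k']
  have : ∀ j, ∫ x, ∑ k, ∑ j', ∑ k', centredPair μ B j k x * centredPair μ B j' k' x
      ∂(Measure.pi fun _ : Fin n => μ) ≤ 4 * (n : ℝ) ^ 2 := by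
    intro j
    rw [integral_finsetSum _ fun k _ =>
      integrable_finsetSum _ fun j' _ => integrable_finsetSum _ fun k' _ => hint j k j' k']
    have h2 : ∀ k, ∫ x, ∑ j', ∑ k', centredPair μ B j k x * centredPair μ B j' k' x
        ∂(Measure.pi fun _ : Fin n => μ) ≤ 4 * (n : ℝ) := by
      intro k
      rw [integral_finsetSum _ fun j' _ => integrable_finsetSum _ fun k' _ => hint j k j' k']
      have h3 : ∀ j', ∫ x, ∑ k', centredPair μ B j k x * centredPair μ B j' k' x
          ∂(Measure.pi fun _ : Fin n => μ) ≤ ∑ k' : Fin n, ((if j = j' then 1 else 0) +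
            (if j = k' then 1 else 0) + (if k = j' then 1 else 0) +
            (if k = k' then 1 else 0) : ℝ) := by
        intro j'
        rw [integral_finsetSum _ fun k' _ => hint j k j' k']
        exact Finset.sum_le_sum fun k' _ => integral_centredPair_mul_le μ hB j k j' k'
      refine (Finset.sum_le_sum fun j' _ => h3 j').trans (le_of_eq ?_)
      simp [Finset.sum_add_distrib]
      ring
    refine (Finset.sum_le_sum fun k _ => h2 k).trans (le_of_eq ?_)
    simp
    ring
  refine (Finset.sum_le_sum fun j _ => this j).trans (le_of_eq ?_)
  simp
  ring

/-- Chebyshev's inequality for the number of pairs of sample points in `B`. -/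
lemma measureReal_pairCount_deviation_le (hB : MeasurableSet B) {n : ℕ} (hn : 0 < n)
    {η : ℝ} (hη : 0 < η) :
    (Measure.pi fun _ : Fin n => μ).real
      {x | η * (n : ℝ) ^ 2 ≤ |pairCount B x - n * (n - 1) * (μ.prod μ).real B|} ≤
        4 / η ^ 2 / n := by
  have hn' : (0 : ℝ) < n := by exact_mod_cast hn
  obtain ⟨hi, hle⟩ := integral_sq_pairCount_sub_le μ hB n
  have h := mul_meas_ge_le_integral_of_nonneg (.of_forall fun x => sq_nonneg _) hi
    ((η * (n : ℝ) ^ 2) ^ 2)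
  have hsub : {x : Fin n → E | η * (n : ℝ) ^ 2 ≤
      |pairCount B x - n * (n - 1) * (μ.prod μ).real B|} ⊆
      {x | (η * (n : ℝ) ^ 2) ^ 2 ≤ (pairCount B x - n * (n - 1) * (μ.prod μ).real B) ^ 2} := by
    intro x hx
    rw [Set.mem_ofPred_eq, ← sq_abs (pairCount B x - _)]
    exact pow_le_pow_left₀ (by positivity) hx 2
  refine (measureReal_mono hsub).trans ?_
  have h' := h.trans hle
  rw [div_div, le_div_iff₀ (by positivity)]
  have h4 : (0 : ℝ) < (n : ℝ) ^ 3 := by positivity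
  refine le_of_mul_le_mul_right ?_ h4
  calc _ = _ := by ring
    _ ≤ _ := h'

lemma tendsto_measureReal_pairCount_deviation (hB : MeasurableSet B) {η : ℝ} (hη : 0 < η) :
    Tendsto (fun n : ℕ => (Measure.pi fun _ : Fin n => μ).real
      {x | η * (n : ℝ) ^ 2 ≤ |pairCount B x - n * (n - 1) * (μ.prod μ).real B|})
      atTop (𝓝 0) :=
  squeeze_zero' (.of_forall fun _ => measureReal_nonneg)
    ((eventually_gt_atTop 0).mono fun _ hn => measureReal_pairCount_deviation_le μ hB hn hη)
    (tendsto_const_div_atTop_nhds_zero_nat _)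

lemma tendsto_measureReal_lt_pairCount (hB : MeasurableSet B) {a : ℕ → ℝ} {L : ℝ}
    (ha : Tendsto (fun n => a n / (n : ℝ) ^ 2) atTop (𝓝 L)) (hL : (μ.prod μ).real B < L) :
    Tendsto (fun n : ℕ => (Measure.pi fun _ : Fin n => μ).real {x | a n < pairCount B x})
      atTop (𝓝 0) := by
  set q := (μ.prod μ).real B with hq
  have hq0 : 0 ≤ q := measureReal_nonneg
  have hη : 0 < (L - q) / 2 := by linarith
  refine squeeze_zero' (.of_forall fun _ => measureReal_nonneg) ?_
    (tendsto_measureReal_pairCount_deviation μ hB hη)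
  filter_upwards [eventually_gt_atTop 0,
    ha.eventually_const_lt (show L - (L - q) / 2 < L by linarith)] with n hn han
  have hn' : (0 : ℝ) < n := by exact_mod_cast hn
  rw [lt_div_iff₀ (by positivity)] at han
  refine measureReal_mono fun x hx => ?_
  rw [Set.mem_ofPred_eq] at hx ⊢
  refine le_trans ?_ (le_abs_self _)
  have := mul_nonneg hn'.le hq0
  linear_combination hx + han + this

lemma tendsto_measureReal_pairCount_le (hB : MeasurableSet B) {a : ℕ → ℝ} {L : ℝ}
    (ha : Tendsto (fun n => a n / (n : ℝ) ^ 2) atTop (𝓝 L)) (hL : L < (μ.prod μ).real B) :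
    Tendsto (fun n : ℕ => (Measure.pi fun _ : Fin n => μ).real {x | pairCount B x ≤ a n})
      atTop (𝓝 0) := by
  set q := (μ.prod μ).real B with hq
  -- One third of the gap pays for `a n / n ^ 2` exceeding `L`, one for replacing `n * (n - 1)` by
  -- `n ^ 2`, and one is left as the deviation. For the upper tail the second error has the
  -- favourable sign, so halves suffice there.
  have hη : 0 < (q - L) / 3 := by linarith
  refine squeeze_zero' (.of_forall fun _ => measureReal_nonneg) ?_
    (tendsto_measureReal_pairCount_deviation μ hB hη)
  filter_upwards [eventually_gt_atTop 0,
    ha.eventually_lt_const (show L < L + (q - L) / 3 by linarith),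
    (tendsto_const_div_atTop_nhds_zero_nat q).eventually_lt_const hη] with n hn han hqn
  have hn' : (0 : ℝ) < n := by exact_mod_cast hn
  rw [div_lt_iff₀ (by positivity)] at han hqn
  refine measureReal_mono fun x hx => ?_
  rw [Set.mem_ofPred_eq] at hx ⊢
  refine le_trans ?_ (neg_le_abs _)
  have := mul_le_mul_of_nonneg_left hqn.le hn'.le
  linear_combination hx + han + this

end PairCount

/-! ### Stress as a count of far pairs -/

lemma mem_hopBall_one {V : Type*} [Fintype V] (G : SimpleGraph V) (v s : V) :
    s ∈ hopBall G v 1 ↔ s = v ∨ G.Adj v s := by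
  simp only [hopBall, Finset.mem_filter, Finset.mem_univ, true_and, Nat.cast_one]
  constructor
  · intro h
    by_cases hs : v = s
    · exact Or.inl hs.symm
    · right
      rw [← SimpleGraph.edist_eq_one_iff_adj]
      refine le_antisymm h ?_
      rw [Order.one_le_iff_ne_zero]
      simpa using hs
  · rintro (rfl | h)
    · simp
    · exact (SimpleGraph.edist_eq_one_iff_adj.2 h).le

/-- Two neighbours of `v` are at distance 1 or 2. In the first case a shortest walk is a single edge
and misses `v`; in the second, a walk of length 2 visiting `v` has it in the middle and is unique.
-/
lemma shortestPathsThrough_of_adj_of_adj {V : Type*} (G : SimpleGraph V) {s t v : V}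
    (hs : G.Adj v s) (ht : G.Adj v t) (hst : s ≠ t) [Decidable (G.Adj s t)] :
    shortestPathsThrough G s t v = if G.Adj s t then 0 else 1 := by
  have h1 : ¬ (v = s ∨ v = t) := by
    rintro (rfl | rfl)
    · exact hs.ne rfl
    · exact ht.ne rfl
  unfold shortestPathsThrough
  rw [if_neg h1]
  split_ifs with hadj
  · have hd : G.dist s t = 1 := SimpleGraph.dist_eq_one_iff_adj.2 hadj
    rw [hd]
    have hempty : {p : G.Walk s t | p.length = 1 ∧ v ∈ p.support} = ∅ := by
      rw [Set.eq_empty_iff_forall_notMem]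
      rintro p ⟨hp, hv⟩
      match p, hp, hv with
      | .cons h .nil, _, hv =>
        simp at hv
        exact h1 hv
    rw [hempty, Set.ncard_empty]
  · have hd : G.dist s t = 2 := by
      refine le_antisymm ((SimpleGraph.dist_le (.cons hs.symm (.cons ht .nil))).trans (by simp)) ?_
      have hr : G.Reachable s t := ⟨.cons hs.symm (.cons ht .nil)⟩
      have h0 := hr.pos_dist_of_ne hst
      have h2 : G.dist s t ≠ 1 := fun h => hadj (SimpleGraph.dist_eq_one_iff_adj.1 h)
      omega
    rw [hd, Set.ncard_eq_one]
    refine ⟨.cons hs.symm (.cons ht .nil), ?_⟩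
    ext p
    simp only [Set.mem_ofPred_eq, Set.mem_singleton_iff]
    constructor
    · rintro ⟨hp, hv⟩
      match p, hp, hv with
      | .cons (v := w) h (.cons h' .nil), _, hv =>
        simp at hv
        obtain rfl : v = w := by tauto
        rfl
    · rintro rfl
      simp

/-- The pairs of points at distance more than `r` in the disk of radius `s` about `w`. -/
def farPairs (r : ℝ) (w : Plane) (s : ℝ) : Set (Plane × Plane) :=
  {z | dist z.1 w ≤ s ∧ dist z.2 w ≤ s ∧ r < dist z.1 z.2}

lemma two_mul_restrictedStress {n : ℕ} (r : ℝ) (x : Fin n → Plane) (i : Fin n) :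
    2 * restrictedStress (commGraph r x) i 1 = pairCount (farPairs r (x i) r) x := by
  classical
  unfold restrictedStress pairCount
  rw [mul_div_cancel₀ _ two_ne_zero]
  push_cast
  have hsub : hopBall (commGraph r x) i 1 ⊆ Finset.univ := Finset.subset_univ _
  rw [← Finset.sum_subset hsub]
  · refine Finset.sum_congr rfl fun s hs => ?_
    rw [Finset.sum_filter, ← Finset.sum_subset hsub]
    · refine Finset.sum_congr rfl fun t ht => ?_
      rw [mem_hopBall_one] at hs ht
      by_cases hst : s = t
      · simp [hst]
      rw [if_pos (Ne.symm hst), if_neg hst]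
      -- The node itself belongs to its hop ball but counts on neither side: it is no inner vertex
      -- of a path from itself, and every point of its disk is within `r` of it.
      by_cases hsi : s = i
      · subst hsi
        rw [Set.indicator_of_notMem]
        · simp [shortestPathsThrough]
        · rintro ⟨-, h2, h3⟩
          simp only [dist_comm] at h2 h3
          linarith
      by_cases hti : t = i
      · subst hti
        rw [Set.indicator_of_notMem]
        · simp [shortestPathsThrough]
        · rintro ⟨h1, -, h3⟩
          simp only at h1 h3
          linarith
      replace hs := hs.resolve_left hsi
      replace ht := ht.resolve_left hti
      rw [shortestPathsThrough_of_adj_of_adj _ hs ht hst]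
      have hs2 : dist (x s) (x i) ≤ r := by rw [dist_comm]; exact hs.2
      have ht2 : dist (x t) (x i) ≤ r := by rw [dist_comm]; exact ht.2
      simp [Set.indicator_apply, farPairs, commGraph, hs2, ht2, hst, ← not_le]
    · intro t _ ht
      rw [mem_hopBall_one, not_or] at ht
      split_ifs
      · rfl
      · refine Set.indicator_of_notMem (fun h => ht.2 ⟨Ne.symm ht.1, ?_⟩) _
        rw [dist_comm]
        exact h.2.1
  · intro s _ hs
    rw [mem_hopBall_one, not_or] at hs
    refine Finset.sum_eq_zero fun t _ => ?_
    split_ifs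
    · rfl
    · refine Set.indicator_of_notMem (fun h => hs.2 ⟨Ne.symm hs.1, ?_⟩) _
      rw [dist_comm]
      exact h.1

/-! ### Volume of the far pairs of a disk -/

lemma measurableSet_farPairs (r : ℝ) (w : Plane) (s : ℝ) : MeasurableSet (farPairs r w s) := by
  have h1 : MeasurableSet {z : Plane × Plane | dist z.1 w ≤ s} :=
    measurableSet_le (by fun_prop) (by fun_prop)
  have h2 : MeasurableSet {z : Plane × Plane | dist z.2 w ≤ s} :=
    measurableSet_le (by fun_prop) (by fun_prop)
  have h3 : MeasurableSet {z : Plane × Plane | r < dist z.1 z.2} :=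
    measurableSet_lt (by fun_prop) (by fun_prop)
  exact h1.inter (h2.inter h3)

lemma farPairs_subset_farPairs {r s s' : ℝ} {w w' : Plane} (h : dist w w' + s ≤ s') :
    farPairs r w s ⊆ farPairs r w' s' := by
  rintro ⟨u, v⟩ ⟨h1, h2, h3⟩
  simp only at h1 h2 h3
  exact ⟨by linarith [dist_triangle u w w'], by linarith [dist_triangle v w w'], h3⟩

lemma farPairs_subset_prod (r : ℝ) (w : Plane) (s : ℝ) :
    farPairs r w s ⊆ Metric.closedBall w s ×ˢ Metric.closedBall w s :=
  fun _ h => ⟨h.1, h.2.1⟩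

lemma volume_farPairs_ne_top (r : ℝ) (w : Plane) (s : ℝ) :
    volume (farPairs r w s) ≠ ⊤ := by
  refine ne_top_of_le_ne_top ?_ (measure_mono (farPairs_subset_prod r w s))
  rw [Measure.volume_eq_prod, Measure.prod_prod]
  exact ENNReal.mul_ne_top measure_closedBall_lt_top.ne measure_closedBall_lt_top.ne

/-- Far pairs scale under a homothety applied to both points, and the space of pairs has dimension
4. -/
lemma volume_real_farPairs_scale {r : ℝ} (hr : 0 < r) (w : Plane) :
    volume.real (farPairs r w r) = r ^ 4 * volume.real (farPairs 1 0 1) := by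
  have himg : farPairs r w r = (fun z : Plane × Plane => -(w, w) + z) ⁻¹' (r • farPairs 1 0 1) := by
    ext ⟨u, v⟩
    rw [Set.mem_preimage, Set.mem_smul_set_iff_inv_smul_mem₀ hr.ne']
    simp only [farPairs, Set.mem_ofPred_eq, Prod.smul_fst, Prod.smul_snd, Prod.fst_add,
      Prod.snd_add, Prod.fst_neg, Prod.snd_neg, dist_zero_right]
    rw [dist_smul₀, norm_smul, norm_smul, dist_add_left, norm_inv, Real.norm_of_nonneg hr.le,
      inv_mul_le_iff₀ hr, inv_mul_le_iff₀ hr, lt_inv_mul_iff₀ hr, mul_one,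
      neg_add_eq_sub, neg_add_eq_sub, ← dist_eq_norm, ← dist_eq_norm]
  rw [himg, Measure.real, Measure.volume_eq_prod, measure_preimage_add, Measure.addHaar_smul]
  simp [abs_of_pos hr, Measure.real, ENNReal.toReal_mul, hr.le]

lemma volume_real_closedBall_scale {r : ℝ} (hr : 0 < r) (w : Plane) :
    volume.real (Metric.closedBall w r) = r ^ 2 * volume.real (Metric.closedBall (0 : Plane) 1) := by
  rw [Measure.real, Measure.addHaar_closedBall' _ _ hr.le]
  simp [ENNReal.toReal_mul, hr.le, Measure.real]

lemma volume_real_closedBall_pos {r : ℝ} (hr : 0 < r) (w : Plane) :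
    0 < volume.real (Metric.closedBall w r) :=
  ENNReal.toReal_pos (Metric.measure_closedBall_pos _ _ hr).ne' measure_closedBall_lt_top.ne

/-- By Fubini: the slice over `u` in the unit disk is that disk minus the disk about `u`. -/
lemma interiorFraction_mul_sq :
    interiorFraction * volume.real (Metric.closedBall (0 : Plane) 1) ^ 2 =
      volume.real (farPairs 1 0 1) := by
  have hb := volume_real_closedBall_pos one_pos (0 : Plane)
  unfold interiorFraction
  rw [integral_div]
  set b := volume.real (Metric.closedBall (0 : Plane) 1)
  have : volume.real (farPairs 1 0 1) = ∫ w in Metric.closedBall (0 : Plane) 1,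
      volume.real (Metric.closedBall (0 : Plane) 1 \ Metric.closedBall w 1) := by
    rw [← integral_indicator measurableSet_closedBall]
    have h := integral_indicator_one (μ := (volume : Measure (Plane × Plane)))
      (measurableSet_farPairs 1 0 1)
    rw [← h, Measure.volume_eq_prod, integral_prod]
    · refine integral_congr_ae (.of_forall fun u => ?_)
      simp only
      by_cases hu : u ∈ Metric.closedBall (0 : Plane) 1
      · rw [Set.indicator_of_mem hu, ← integral_indicator_one
          (measurableSet_closedBall.diff measurableSet_closedBall)]
        refine integral_congr_ae (.of_forall fun v => ?_)
        have : (u, v) ∈ farPairs 1 0 1 ↔ v ∈ Metric.closedBall 0 1 \ Metric.closedBall u 1 := by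
          rw [Metric.mem_closedBall] at hu
          simp only [farPairs, Set.mem_ofPred_eq, Set.mem_sdiff, Metric.mem_closedBall, hu,
            true_and, not_le, dist_comm u v]
        beta_reduce
        by_cases hv : (u, v) ∈ farPairs 1 0 1
        · rw [Set.indicator_of_mem hv, Set.indicator_of_mem (this.1 hv), Pi.one_apply, Pi.one_apply]
        · rw [Set.indicator_of_notMem hv, Set.indicator_of_notMem (mt this.2 hv)]
      · rw [Set.indicator_of_notMem hu]
        refine integral_eq_zero_of_ae (.of_forall fun v => ?_)
        exact Set.indicator_of_notMem (fun h => hu h.1) _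
    · refine IntegrableOn.integrable_indicator ?_ (measurableSet_farPairs 1 0 1)
      exact integrableOn_const (volume_farPairs_ne_top 1 0 1)
  rw [this]
  field_simp

lemma volume_real_farPairs {r : ℝ} (hr : 0 < r) (w : Plane) :
    volume.real (farPairs r w r) =
      interiorFraction * volume.real (Metric.closedBall (0 : Plane) r) ^ 2 := by
  rw [volume_real_farPairs_scale hr, volume_real_closedBall_scale hr, ← interiorFraction_mul_sq]
  ring

/-! ### Far-pair probabilities in the interior and near the frontier -/

lemma cond_prod_cond_real (R : Set Plane) {B : Set (Plane × Plane)} (hB : MeasurableSet B) :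
    ((volume[|R]).prod (volume[|R])).real B =
      volume.real (B ∩ R ×ˢ R) / volume.real R ^ 2 := by
  unfold ProbabilityTheory.cond
  rw [Measure.prod_smul_left, Measure.prod_smul_right, Measure.prod_restrict, Measure.real,
    Measure.smul_apply, Measure.smul_apply, Measure.restrict_apply hB, ← Measure.volume_eq_prod]
  simp [Measure.real, ENNReal.toReal_mul]
  ring

lemma cond_prod_cond_real_farPairs {R : Set Plane} {r : ℝ} (hr : 0 < r) {w : Plane}
    (h : Metric.closedBall w r ⊆ R) :
    ((volume[|R]).prod (volume[|R])).real (farPairs r w r) = interiorFraction *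
      (volume.real (Metric.closedBall (0 : Plane) r) / volume.real R) ^ 2 := by
  rw [cond_prod_cond_real R (measurableSet_farPairs r w r), Set.inter_eq_left.2
    ((farPairs_subset_prod r w r).trans (Set.prod_mono h h)), volume_real_farPairs hr]
  ring

/-- The open disk about `w` contains a point `u` outside `R`. Pairing `u` with a point almost
diametrically opposite gives a far pair not in `R ×ˢ R`, and openness of the conditions thickens it
to positive volume. -/
lemma cond_prod_cond_real_farPairs_lt {R : Set Plane} (hR : IsClosed R)
    (hR0 : 0 < volume.real R) (hfr : (frontier R).Nonempty) {r : ℝ} {w : Plane}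
    (hw : w ∈ R) (hwr : Metric.infDist w (frontier R) < r) :
    ((volume[|R]).prod (volume[|R])).real (farPairs r w r) < interiorFraction *
      (volume.real (Metric.closedBall (0 : Plane) r) / volume.real R) ^ 2 := by
  have hr : 0 < r := Metric.infDist_nonneg.trans_lt hwr
  rw [cond_prod_cond_real R (measurableSet_farPairs r w r), div_pow, ← mul_div_assoc,
    ← volume_real_farPairs hr w]
  refine div_lt_div_of_pos_right ?_ (by positivity)
  obtain ⟨p, hp, hpw⟩ := (Metric.infDist_lt_iff hfr).1 hwr
  have hpc : p ∈ closure Rᶜ := frontier_subset_closure (frontier_compl R ▸ hp)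
  obtain ⟨u, huB, huR⟩ := mem_closure_iff.1 hpc (Metric.ball w r) Metric.isOpen_ball
    (by rwa [Metric.mem_ball, dist_comm])
  set O : Set (Plane × Plane) :=
    {z | z.1 ∈ Rᶜ ∧ dist z.1 w < r ∧ dist z.2 w < r ∧ r < dist z.1 z.2} with hO
  have hOopen : IsOpen O := by
    have h1 : IsOpen {z : Plane × Plane | dist z.1 w < r} :=
      isOpen_lt (by fun_prop) (by fun_prop)
    have h2 : IsOpen {z : Plane × Plane | dist z.2 w < r} :=
      isOpen_lt (by fun_prop) (by fun_prop)
    have h3 : IsOpen {z : Plane × Plane | r < dist z.1 z.2} :=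
      isOpen_lt (by fun_prop) (by fun_prop)
    exact (hR.isOpen_compl.preimage continuous_fst).inter (h1.inter (h2.inter h3))
  have huw : u ≠ w := fun h => huR (h ▸ hw)
  have hd : 0 < ‖u - w‖ := norm_pos_iff.2 (sub_ne_zero.2 huw)
  have hdr : ‖u - w‖ < r := by rwa [Metric.mem_ball, dist_eq_norm] at huB
  have hOne : O.Nonempty := by
    -- The partner of `u` lies opposite `u` at distance `r - ‖u - w‖ / 2` from `w`: inside the open
    -- disk, and at distance `r + ‖u - w‖ / 2` from `u`.
    set t : ℝ := (r - ‖u - w‖ / 2) / ‖u - w‖ with ht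
    have htd : t * ‖u - w‖ = r - ‖u - w‖ / 2 := by rw [ht]; field_simp
    have ht0 : 0 < t := by apply div_pos <;> linarith
    refine ⟨(u, w - t • (u - w)), huR, huB, ?_, ?_⟩
    · rw [dist_eq_norm, sub_sub_cancel_left, norm_neg, norm_smul, Real.norm_of_nonneg ht0.le, htd]
      linarith
    · rw [dist_eq_norm, show u - (w - t • (u - w)) = (1 + t) • (u - w) by module, norm_smul,
        Real.norm_of_nonneg (by linarith), add_mul, htd]
      linarith
  have hOpos : 0 < volume O := hOopen.measure_pos _ hOne
  have hOsub : O ⊆ farPairs r w r := fun z hz => ⟨hz.2.1.le, hz.2.2.1.le, hz.2.2.2⟩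
  have hOtop : volume O ≠ ⊤ := ne_top_of_le_ne_top (volume_farPairs_ne_top r w r)
    (measure_mono hOsub)
  have hdisj : Disjoint (farPairs r w r ∩ R ×ˢ R) O :=
    Set.disjoint_left.2 fun z hz hz' => hz'.1 hz.2.1
  have hadd := measureReal_union (μ := volume) hdisj hOopen.measurableSet
    (ne_top_of_le_ne_top (volume_farPairs_ne_top r w r) (measure_mono Set.inter_subset_left)) hOtop
  have hle := measureReal_mono (μ := volume)
    (Set.union_subset Set.inter_subset_left hOsub : farPairs r w r ∩ R ×ˢ R ∪ O ⊆ farPairs r w r)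
    (volume_farPairs_ne_top r w r)
  have : 0 < volume.real O := ENNReal.toReal_pos hOpos.ne' hOtop
  linarith

/-! ### Continuity in the radius of the disk -/

lemma exists_measureReal_farPairs_lt (ν : Measure (Plane × Plane)) [IsFiniteMeasure ν]
    {r b : ℝ} {w : Plane} (h : ν.real (farPairs r w r) < b) :
    ∃ δ > 0, ν.real (farPairs r w (r + δ)) < b := by
  have hInter : ⋂ j : ℕ, farPairs r w (r + 1 / ((j : ℝ) + 1)) = farPairs r w r := by
    apply Set.Subset.antisymm
    · intro z hz
      rw [Set.mem_iInter] at hz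
      have hlim : Tendsto (fun j : ℕ => r + 1 / ((j : ℝ) + 1)) atTop (𝓝 r) := by
        simpa using tendsto_one_div_add_atTop_nhds_zero_nat.const_add r
      exact ⟨ge_of_tendsto' hlim fun j => (hz j).1, ge_of_tendsto' hlim fun j => (hz j).2.1,
        (hz 0).2.2⟩
    · refine Set.subset_iInter fun j => farPairs_subset_farPairs ?_
      have : 0 < 1 / ((j : ℝ) + 1) := by positivity
      rw [dist_self]
      linarith
  have hanti : Antitone fun j : ℕ => farPairs r w (r + 1 / ((j : ℝ) + 1)) := by
    intro i j hij
    refine farPairs_subset_farPairs ?_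
    have := Nat.one_div_le_one_div (α := ℝ) hij
    rw [dist_self]
    linarith
  have ht := tendsto_measure_iInter_atTop (μ := ν)
    (fun j : ℕ => (measurableSet_farPairs r w (r + 1 / ((j : ℝ) + 1))).nullMeasurableSet) hanti
    ⟨0, measure_ne_top _ _⟩
  rw [hInter] at ht
  have ht' := (ENNReal.tendsto_toReal (measure_ne_top ν _)).comp ht
  obtain ⟨j, hj⟩ := (ht'.eventually_lt_const h).exists
  exact ⟨1 / ((j : ℝ) + 1), by positivity, hj⟩

/-- Continuity from below yields only the pairs in the open disk. Pairs touching the bounding circle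
are null for the uniform law, so nothing is lost; a general finite measure would not do here. -/
lemma exists_lt_measureReal_farPairs (R : Set Plane) {r b : ℝ} {w : Plane}
    (h : b < ((volume[|R]).prod (volume[|R])).real (farPairs r w r)) :
    ∃ δ > 0, b < ((volume[|R]).prod (volume[|R])).real (farPairs r w (r - δ)) := by
  set ν := (volume[|R]).prod (volume[|R])
  have hmono : Monotone fun j : ℕ => farPairs r w (r - 1 / ((j : ℝ) + 1)) := by
    intro i j hij
    refine farPairs_subset_farPairs ?_
    have := Nat.one_div_le_one_div (α := ℝ) hij
    rw [dist_self]
    linarith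
  have hsphere : volume[|R] (Metric.sphere w r) = 0 :=
    cond_absolutelyContinuous (Measure.addHaar_sphere _ w r)
  have hUnion : ν (⋃ j : ℕ, farPairs r w (r - 1 / ((j : ℝ) + 1))) = ν (farPairs r w r) := by
    apply le_antisymm
    · refine measure_mono (Set.iUnion_subset fun j => farPairs_subset_farPairs ?_)
      have : 0 < 1 / ((j : ℝ) + 1) := by positivity
      rw [dist_self]
      linarith
    · have hsub : farPairs r w r ⊆ (⋃ j : ℕ, farPairs r w (r - 1 / ((j : ℝ) + 1))) ∪
          (Metric.sphere w r ×ˢ Set.univ ∪ Set.univ ×ˢ Metric.sphere w r) := by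
        rintro ⟨u, v⟩ ⟨h1, h2, h3⟩
        simp only at h1 h2 h3
        by_cases hu : dist u w = r
        · exact Or.inr (Or.inl ⟨hu, trivial⟩)
        by_cases hv : dist v w = r
        · exact Or.inr (Or.inr ⟨trivial, hv⟩)
        left
        obtain ⟨j, hj⟩ := exists_nat_one_div_lt (show 0 < r - max (dist u w) (dist v w) from
          sub_pos.2 (max_lt (lt_of_le_of_ne h1 hu) (lt_of_le_of_ne h2 hv)))
        refine Set.mem_iUnion.2 ⟨j, ?_, ?_, h3⟩
        · linarith [le_max_left (dist u w) (dist v w)]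
        · linarith [le_max_right (dist u w) (dist v w)]
      refine (measure_mono hsub).trans ((measure_union_le _ _).trans ?_)
      have : ν (Metric.sphere w r ×ˢ Set.univ ∪ Set.univ ×ˢ Metric.sphere w r) = 0 := by
        refine measure_union_null ?_ ?_ <;> simp [ν, Measure.prod_prod, hsphere]
      rw [this, add_zero]
  have ht := tendsto_measure_iUnion_atTop (μ := ν) hmono
  rw [hUnion] at ht
  have ht' := (ENNReal.tendsto_toReal (measure_ne_top ν _)).comp ht
  obtain ⟨j, hj⟩ := (ht'.eventually_const_lt h).exists
  exact ⟨1 / ((j : ℝ) + 1), by positivity, hj⟩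

/-! ### Topology of the region -/

lemma IsPolygonalRegion.isCompact {R : Set Plane} (hR : IsPolygonalRegion R) : IsCompact R := by
  obtain ⟨𝒯, -, -, rfl⟩ := hR
  exact 𝒯.isCompact_biUnion fun T _ => (Set.finite_range T).isCompact_convexHull ℝ

lemma IsPolygonalRegion.volume_real_pos {R : Set Plane} (hR : IsPolygonalRegion R) :
    0 < volume.real R := by
  have hc := hR.isCompact
  obtain ⟨𝒯, ⟨T, hT⟩, hind, rfl⟩ := hR
  refine ENNReal.toReal_pos (Measure.measure_pos_of_nonempty_interior _ ?_).ne'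
    hc.measure_lt_top.ne
  have hne : (interior (convexHull ℝ (Set.range T))).Nonempty := by
    rw [interior_convexHull_nonempty_iff_affineSpan_eq_top,
      (hind T hT).affineSpan_eq_top_iff_card_eq_finrank_add_one]
    simp
  exact hne.mono (interior_mono
    (Set.subset_biUnion_of_mem (u := fun T => convexHull ℝ (Set.range T)) hT))

lemma frontier_nonempty_of_isCompact {R : Set Plane} (hR : IsCompact R) (hne : R.Nonempty) :
    (frontier R).Nonempty :=
  nonempty_frontier_iff.2 ⟨hne, fun h => noncompact_univ Plane (h ▸ hR)⟩

/-- The open ball is connected, misses the frontier and has its centre in `R`, so it cannot leave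
the interior; closedness of `R` adds the bounding circle. -/
lemma closedBall_subset_of_le_infDist_frontier {R : Set Plane} (hR : IsClosed R) {r : ℝ}
    (hr : 0 < r) {w : Plane} (hw : w ∈ R) (hwr : r ≤ Metric.infDist w (frontier R)) :
    Metric.closedBall w r ⊆ R := by
  have hdisj : ∀ z ∈ Metric.ball w r, z ∉ frontier R := fun z hz hzf => by
    have := Metric.infDist_le_dist_of_mem (x := w) hzf
    rw [Metric.mem_ball, dist_comm] at hz
    linarith
  have hint : ∀ z ∈ Metric.ball w r, z ∈ R → z ∈ interior R := fun z hz hzR => by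
    by_contra h
    exact hdisj z hz ⟨subset_closure hzR, h⟩
  have hsub : Metric.ball w r ⊆ interior R :=
    (convex_ball w r).isPreconnected.subset_left_of_subset_union isOpen_interior
      hR.isOpen_compl (disjoint_compl_right.mono_left interior_subset)
      (fun z hz => by
        by_cases h : z ∈ R
        · exact Or.inl (hint z hz h)
        · exact Or.inr h)
      ⟨w, Metric.mem_ball_self hr, hint w (Metric.mem_ball_self hr) hw⟩
  rw [← closure_ball w hr.ne']
  exact closure_minimal (hsub.trans interior_subset) hR

/-! ### The threshold and the finite covers -/

lemma tendsto_threshold (R : Set Plane) (r θ : ℝ) :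
    Tendsto (fun n : ℕ => θ * (expectedDegree R r n * (expectedDegree R r n - 1)) / (n : ℝ) ^ 2)
      atTop (𝓝 (θ * (volume.real (Metric.closedBall (0 : Plane) r) / volume.real R) ^ 2)) := by
  unfold expectedDegree
  set c := volume.real (Metric.closedBall (0 : Plane) r) / volume.real R
  have h0 : Tendsto (fun n : ℕ => ((n : ℝ))⁻¹) atTop (𝓝 0) := tendsto_inv_atTop_nhds_zero_nat
  have h := (((h0.const_sub 1).mul_const c).mul
    (((h0.const_sub 1).mul_const c).sub h0)).const_mul θ
  refine (h.congr' ?_).trans (by simp [sq])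
  filter_upwards [eventually_gt_atTop 0] with n hn
  have hn' : (n : ℝ) ≠ 0 := by positivity
  field_simp

lemma declaresBoundary_iff (R : Set Plane) (r θ : ℝ) {n : ℕ} (x : Fin n → Plane) (i : Fin n) :
    DeclaresBoundary R r θ x i ↔ pairCount (farPairs r (x i) r) x ≤
      θ * (expectedDegree R r n * (expectedDegree R r n - 1)) := by
  unfold DeclaresBoundary
  rw [← two_mul_restrictedStress]
  constructor <;> intro h <;> linarith

/-- Finitely many disks, slightly larger than the communication disks, control all
communication disks about the points of `K`. -/
lemma exists_finite_enlarged_cover (ν : Measure (Plane × Plane)) [IsFiniteMeasure ν]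
    {K : Set Plane} (hK : IsCompact K) {r b : ℝ} (h : ∀ w ∈ K, ν.real (farPairs r w r) < b) :
    ∃ (t : Finset Plane) (s : Plane → ℝ), (∀ w ∈ t, ν.real (farPairs r w (s w)) < b) ∧
      ∀ u ∈ K, ∃ w ∈ t, farPairs r u r ⊆ farPairs r w (s w) := by
  choose! δ hδ hb using fun w hw => exists_measureReal_farPairs_lt ν (h w hw)
  -- The covering ball about `w` has radius equal to the enlargement `δ w`, so the triangle
  -- inequality puts the `r`-disk of each of its points inside the enlarged disk.
  obtain ⟨t, htK, hcov⟩ := hK.elim_nhds_subcover (fun w => Metric.ball w (δ w))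
    fun w hw => Metric.ball_mem_nhds w (hδ w hw)
  refine ⟨t, fun w => r + δ w, fun w hw => hb w (htK w hw), fun u hu => ?_⟩
  obtain ⟨w, hw, huw⟩ := Set.mem_iUnion₂.1 (hcov hu)
  rw [Metric.mem_ball] at huw
  exact ⟨w, hw, farPairs_subset_farPairs (by linarith)⟩

/-- Finitely many disks, slightly smaller than the communication disks, control all
communication disks about the points of `K`. -/
lemma exists_finite_shrunk_cover (R : Set Plane) {K : Set Plane} (hK : IsCompact K) {r b : ℝ}
    (h : ∀ w ∈ K, b < ((volume[|R]).prod (volume[|R])).real (farPairs r w r)) :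
    ∃ (t : Finset Plane) (s : Plane → ℝ),
      (∀ w ∈ t, b < ((volume[|R]).prod (volume[|R])).real (farPairs r w (s w))) ∧
      ∀ u ∈ K, ∃ w ∈ t, farPairs r w (s w) ⊆ farPairs r u r := by
  choose! δ hδ hb using fun w hw => exists_lt_measureReal_farPairs R (h w hw)
  obtain ⟨t, htK, hcov⟩ := hK.elim_nhds_subcover (fun w => Metric.ball w (δ w))
    fun w hw => Metric.ball_mem_nhds w (hδ w hw)
  refine ⟨t, fun w => r - δ w, fun w hw => hb w (htK w hw), fun u hu => ?_⟩
  obtain ⟨w, hw, huw⟩ := Set.mem_iUnion₂.1 (hcov hu)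
  rw [Metric.mem_ball, dist_comm] at huw
  exact ⟨w, hw, farPairs_subset_farPairs (by linarith)⟩

lemma ae_scatter_mem {R : Set Plane} (hR : MeasurableSet R) [IsProbabilityMeasure (volume[|R])]
    (n : ℕ) : ∀ᵐ x ∂scatter R n, ∀ i, x i ∈ R :=
  ae_all_iff.2 fun i => (measurePreserving_eval (fun _ : Fin n => volume[|R]) i
    ).quasiMeasurePreserving.ae (ae_cond_mem hR)

end SensorNetwork

open SensorNetwork

/-! ### Union bound and choice of the threshold -/

theorem theorem1 (R : Set SensorNetwork.Plane) (hR : SensorNetwork.IsPolygonalRegion R)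
    (r : ℝ) (hr : 0 < r) (ε : ℝ) (hε : 0 < ε) (hεr : ε < r) :
    ∃ θ₀ : ℝ, 0 ≤ θ₀ ∧ θ₀ < SensorNetwork.interiorFraction ∧
      ∀ θ : ℝ, θ₀ < θ → θ < SensorNetwork.interiorFraction →
        ∀ p : ℝ, 0 < p → ∃ ρ₀ : ℝ, ∀ n : ℕ, ρ₀ ≤ (n : ℝ) / volume.real R →
          1 - p ≤ (SensorNetwork.scatter R n).real
            {x : Fin n → SensorNetwork.Plane | SensorNetwork.ClassifiedCorrectly R r ε θ x} := by
  have hc := hR.isCompact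
  have hA := hR.volume_real_pos
  have hvol : volume R ≠ 0 := fun h => by simp [Measure.real, h] at hA
  have : IsProbabilityMeasure (volume[|R]) :=
    cond_isProbabilityMeasure_of_finite hvol hc.measure_lt_top.ne
  have hfr := frontier_nonempty_of_isCompact hc (nonempty_of_measure_ne_zero hvol)
  set q : Set (Plane × Plane) → ℝ := ((volume[|R]).prod (volume[|R])).real with hq
  set c := volume.real (Metric.closedBall (0 : Plane) r) / volume.real R with hcdef
  have hc0 : 0 < c ^ 2 := pow_pos (div_pos (volume_real_closedBall_pos hr 0) hA) 2
  have hinf : Continuous fun w : Plane => Metric.infDist w (frontier R) :=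
    Metric.continuous_infDist_pt _
  have hKb : IsCompact (R ∩ {w | Metric.infDist w (frontier R) ≤ ε}) :=
    hc.inter_right (isClosed_le hinf continuous_const)
  have hKi : IsCompact (R ∩ {w | r ≤ Metric.infDist w (frontier R)}) :=
    hc.inter_right (isClosed_le continuous_const hinf)
  obtain ⟨t, s, hts, hcov⟩ := exists_finite_enlarged_cover ((volume[|R]).prod (volume[|R]))
    hKb (r := r) (b := interiorFraction * c ^ 2) fun w hw =>
      cond_prod_cond_real_farPairs_lt hc.isClosed hA hfr hw.1 (lt_of_le_of_lt hw.2 hεr)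
  -- A maximum over the cover is taken next. Frontier points lie in the boundary zone, so the cover
  -- is not empty.
  have htne : t.Nonempty := by
    obtain ⟨z, hz⟩ := hfr
    obtain ⟨w, hw, -⟩ := hcov z ⟨hc.isClosed.frontier_subset hz,
      (Metric.infDist_zero_of_mem hz).trans_le hε.le⟩
    exact ⟨w, hw⟩
  obtain ⟨w₀, hw₀, hmax⟩ := t.exists_max_image (fun w => q (farPairs r w (s w))) htne
  -- `θ₀ c²` is the largest far-pair probability among the enlarged disks, a maximum over finitely
  -- many numbers below `σ c²`. It is fixed before `θ`; the interior cover below may depend on `θ`.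
  refine ⟨q (farPairs r w₀ (s w₀)) / c ^ 2, div_nonneg measureReal_nonneg hc0.le,
    (div_lt_iff₀ hc0).2 (hts w₀ hw₀), fun θ hθ₀ hθ p hp => ?_⟩
  rw [div_lt_iff₀ hc0] at hθ₀
  obtain ⟨t', s', hts', hcov'⟩ := exists_finite_shrunk_cover R hKi (r := r) (b := θ * c ^ 2)
    fun w hw => by
      rw [cond_prod_cond_real_farPairs hr
        (closedBall_subset_of_le_infDist_frontier hc.isClosed hr hw.1 hw.2)]
      exact mul_lt_mul_of_pos_right hθ hc0
  set a : ℕ → ℝ := fun n => θ * (expectedDegree R r n * (expectedDegree R r n - 1)) with ha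
  have hlim : Tendsto (fun n : ℕ =>
      ∑ w ∈ t, (scatter R n).real {x | a n < pairCount (farPairs r w (s w)) x} +
      ∑ w ∈ t', (scatter R n).real {x | pairCount (farPairs r w (s' w)) x ≤ a n})
      atTop (𝓝 0) := by
    have h1 := tendsto_finsetSum t fun w hw => tendsto_measureReal_lt_pairCount (volume[|R])
      (measurableSet_farPairs r w (s w)) (tendsto_threshold R r θ) ((hmax w hw).trans_lt hθ₀)
    have h2 := tendsto_finsetSum t' fun w hw => tendsto_measureReal_pairCount_le (volume[|R])
      (measurableSet_farPairs r w (s' w)) (tendsto_threshold R r θ) (hts' w hw)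
    have h := h1.add h2
    simp only [Finset.sum_const_zero, add_zero] at h
    exact h
  obtain ⟨N, hN⟩ := eventually_atTop.1 (hlim.eventually_lt_const hp)
  refine ⟨N / volume.real R, fun n hn => ?_⟩
  have hNn : N ≤ n := by exact_mod_cast (div_le_div_iff_of_pos_right hA).1 hn
  have : IsProbabilityMeasure (scatter R n) := by unfold scatter; infer_instance
  have hnull : (scatter R n).real {x | ¬ ∀ i, x i ∈ R} = 0 := by
    rw [Measure.real, ae_iff.1 (ae_scatter_mem hc.measurableSet n), ENNReal.toReal_zero]
  -- Outside a null event and the finitely many deviation events, every node is classified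
  -- correctly, deterministically, by monotonicity of the pair count.
  have huniv : (Set.univ : Set (Fin n → Plane)) ⊆ {x | ClassifiedCorrectly R r ε θ x} ∪
      ({x | ¬ ∀ i, x i ∈ R} ∪ ((⋃ w ∈ t, {x | a n < pairCount (farPairs r w (s w)) x}) ∪
        ⋃ w ∈ t', {x | pairCount (farPairs r w (s' w)) x ≤ a n})) := by
    intro x _
    by_contra hx
    simp only [Set.mem_union, Set.mem_iUnion, Set.mem_ofPred_eq, not_or, not_not, not_exists,
      not_lt, not_le] at hx
    obtain ⟨hx1, hx2, hx3, hx4⟩ := hx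
    refine hx1 fun i => ⟨fun hi => ?_, fun hi => ?_⟩
    · obtain ⟨w, hw, hsub⟩ := hcov (x i) ⟨hx2 i, hi⟩
      exact (declaresBoundary_iff R r θ x i).2 ((pairCount_mono hsub x).trans (hx3 w hw))
    · obtain ⟨w, hw, hsub⟩ := hcov' (x i) ⟨hx2 i, hi⟩
      rw [declaresBoundary_iff, not_le]
      exact (hx4 w hw).trans_le (pairCount_mono hsub x)
  have h1 : (1 : ℝ) ≤ _ := (probReal_univ (μ := scatter R n)).ge.trans (measureReal_mono huniv)
  have h2 := h1.trans ((measureReal_union_le _ _).trans (add_le_add_right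
    ((measureReal_union_le _ _).trans (add_le_add hnull.le ((measureReal_union_le _ _).trans
      (add_le_add (measureReal_biUnion_finset_le _ _) (measureReal_biUnion_finset_le _ _))))) _))
  have h3 := hN n hNn
  linarith
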